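/- For $x\in[0,1)$ and an integer $k\ge 0$ let $J_k(x)$ be the unique dyadic interval $[m2^{-k},(m+1)2^{-k})$, $m\in\mathbb{Z}$, that contains $x$. For an integrable real- or complex-valued function $f$ on $[0,1)$ put $$E_k(f)(x)=2^{k}\int_{J_k(x)} f(y)\,dy,\qquad S(f)(x)=\Bigl(|E_0(f)(x)|^2+\sum_{j=1}^{\infty}|E_j(f)(x)-E_{j-1}(f)(x)|^2\Bigr)^{1/2}\in[0,\infty].$$ Proposition. For each real number $q>2$ there is a constant $C_4(q)>0$, depending only on $q$, such that $$\int_{[0,1)} S(f)(x)^q\,dx\le C_4(q)\int_{[0,1)}|f(x)|^q\,dx$$ for every integrable function $f:[0,1)\to\mathbb{R}$ or $f:[0,1)\to\mathbb{C}$ (the integrals take values in $[0,\infty]$). -/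

import Mathlib

open MeasureTheory
open scoped ENNReal

namespace DyadicSquare

/-- The dyadic interval `[m 2^{-k}, (m+1) 2^{-k})`. -/
def dyadicInterval (k : ℕ) (m : ℤ) : Set ℝ :=
  Set.Ico ((m : ℝ) / 2 ^ k) (((m : ℝ) + 1) / 2 ^ k)

/-- The dyadic interval of length `2^{-k}` that contains `x`. -/
noncomputable def dyadicIntervalAt (k : ℕ) (x : ℝ) : Set ℝ :=
  dyadicInterval k ⌊x * 2 ^ k⌋

/-- `dyadicIntervalAt k x` is the one and only dyadic interval of length `2^{-k}` around `x`. -/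
theorem mem_dyadicInterval_iff (k : ℕ) (m : ℤ) (x : ℝ) :
    x ∈ dyadicInterval k m ↔ m = ⌊x * 2 ^ k⌋ := by
  have h2 : (0 : ℝ) < 2 ^ k := by positivity
  rw [eq_comm, Int.floor_eq_iff, dyadicInterval, Set.mem_Ico, div_le_iff₀ h2, lt_div_iff₀ h2]

/-- For `x` in `[0,1)` this interval is contained in `[0,1)`. -/
theorem dyadicIntervalAt_subset (k : ℕ) {x : ℝ} (hx : x ∈ Set.Ico (0 : ℝ) 1) :
    dyadicIntervalAt k x ⊆ Set.Ico (0 : ℝ) 1 := by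
  have h2 : (0 : ℝ) < 2 ^ k := by positivity
  have h0 : (0 : ℤ) ≤ ⌊x * 2 ^ k⌋ := Int.floor_nonneg.mpr (mul_nonneg hx.1 h2.le)
  have h1 : ⌊x * 2 ^ k⌋ < (2 : ℤ) ^ k := by
    rw [Int.floor_lt]
    push_cast
    nlinarith [hx.2]
  have h0' : (0 : ℝ) ≤ (⌊x * 2 ^ k⌋ : ℝ) := by exact_mod_cast h0
  have h1' : (⌊x * 2 ^ k⌋ : ℝ) + 1 ≤ 2 ^ k := by exact_mod_cast h1
  refine Set.Ico_subset_Ico (div_nonneg h0' h2.le) ?_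
  rw [div_le_one h2]
  exact h1'

/-- The dyadic average `E_k(f)(x) = |J|⁻¹ ∫_J f`, where `J` is the dyadic interval of length
`2^{-k}` that contains `x`. -/
noncomputable def dyadicAvg {𝕜 : Type*} [RCLike 𝕜] (k : ℕ) (f : ℝ → 𝕜) (x : ℝ) : 𝕜 :=
  (2 : ℝ) ^ k • ∫ y in dyadicIntervalAt k x, f y

/-- The square function
`S(f)(x) = (|E_0(f)(x)|² + ∑_{j ≥ 1} |E_j(f)(x) - E_{j-1}(f)(x)|²)^{1/2}`, with values in
`[0, ∞]`; the sum over `j ≥ 1` is indexed by `j = i + 1`. -/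
noncomputable def squareFunction {𝕜 : Type*} [RCLike 𝕜] (f : ℝ → 𝕜) (x : ℝ) : ℝ≥0∞ :=
  (‖dyadicAvg 0 f x‖ₑ ^ 2 + ∑' i : ℕ, ‖dyadicAvg (i + 1) f x - dyadicAvg i f x‖ₑ ^ 2)
    ^ (1 / 2 : ℝ)

end DyadicSquare

/-!
The proof is an explicit Bellman-function (supermartingale) argument with `C = q ^ (q / 2)`.

Put `p = q / 2 > 1`, let `F = E_n f` and let `T = |E_0 f|² + ∑_{j ≤ n} |E_j f - E_{j-1} f|²` be the
truncated square function, squared. On the two halves of a dyadic interval of length `2^{-n}` the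
values of `E_{n+1} f` are `F ± d` for a single `d`, so the new value of `T` is `T + |d|²` on both.
Because of this, the function `U = T ^ (p - 1) * (T - p |F|²)` has, on average over the two halves,
a value at most its old one (`bellman_step`; the only analytic input is the tangent line inequality
for `t ↦ t ^ p`). At level `0` one has `T = |F|²` and `U ≤ 0`, hence the mean of `U` is at most
`0` at every level (`sum_bellman_nonpos`). Absorbing the mixed term in
`mean (T ^ p) ≤ p * mean (T ^ (p - 1) |F|²)` gives `mean (T ^ p) ≤ (2 p) ^ p * mean (|F| ^ q)`
(`sum_partialSq_rpow_le`), where all means are over the finitely many dyadic intervals of level `n`.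

Jensen's inequality on each dyadic interval bounds `mean (|F| ^ q)` by the integral of `|f| ^ q`,
and monotone convergence in `n` finishes the proof.
-/

namespace DyadicSquare

/-! ### Inequalities for real powers -/

theorem rpow_sub_one_mul_self {p u : ℝ} (hp : 1 < p) (hu : 0 ≤ u) : u ^ (p - 1) * u = u ^ p := by
  rw [← Real.rpow_add_one' hu (by linarith), sub_add_cancel]

/-- The tangent line inequality for the convex function `v ↦ v ^ p` at the point `t + s`. -/
theorem add_rpow_le {p t s : ℝ} (hp : 1 < p) (ht : 0 ≤ t) (hs : 0 ≤ s) :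
    (t + s) ^ p ≤ t ^ p + p * s * (t + s) ^ (p - 1) := by
  rcases (add_nonneg ht hs).eq_or_lt with h0 | hv
  · have : t = 0 := by linarith
    have : s = 0 := by linarith
    subst_vars
    simp
  have hb := one_add_mul_self_le_rpow_one_add (s := -s / (t + s)) (p := p)
    (by rw [le_div_iff₀ hv]; linarith) hp.le
  have h1 : 1 + -s / (t + s) = t / (t + s) := by field_simp; ring
  have hvp : 0 < (t + s) ^ p := Real.rpow_pos_of_pos hv p
  rw [h1, Real.div_rpow ht hv.le, le_div_iff₀ hvp] at hb
  have h2 : (t + s) ^ (p - 1) = (t + s) ^ p / (t + s) := Real.rpow_sub_one hv.ne' p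
  rw [h2]
  have h3 : (1 + p * (-s / (t + s))) * (t + s) ^ p
      = (t + s) ^ p - p * s * ((t + s) ^ p / (t + s)) := by ring
  linarith

/-- The Bellman function decreases on average: `c` is the squared norm of a martingale, `a` and `b`
are its next values, and `s` is the squared norm of the jump, so that `(a + b) / 2 = c + s`. -/
theorem bellman_step {p t s a b c : ℝ} (hp : 1 < p) (ht : 0 ≤ t) (hs : 0 ≤ s) (hc : 0 ≤ c)
    (hab : a + b = 2 * (c + s)) :
    (t + s) ^ (p - 1) * ((t + s) - p * a) + (t + s) ^ (p - 1) * ((t + s) - p * b)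
      ≤ 2 * (t ^ (p - 1) * (t - p * c)) := by
  have h1 := add_rpow_le hp ht hs
  have h2 : t ^ (p - 1) ≤ (t + s) ^ (p - 1) :=
    Real.rpow_le_rpow ht (by linarith) (by linarith)
  have h4 := rpow_sub_one_mul_self hp ht
  have h5 := rpow_sub_one_mul_self hp (add_nonneg ht hs)
  have h6 : p * c * t ^ (p - 1) ≤ p * c * (t + s) ^ (p - 1) :=
    mul_le_mul_of_nonneg_left h2 (by positivity)
  have h7 : (t + s) ^ (p - 1) * ((t + s) - p * a) + (t + s) ^ (p - 1) * ((t + s) - p * b)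
      = 2 * ((t + s) ^ (p - 1) * (t + s)) - p * (a + b) * (t + s) ^ (p - 1) := by ring
  rw [h7, hab, h5]
  have h8 : 2 * (t ^ (p - 1) * (t - p * c)) = 2 * (t ^ (p - 1) * t) - 2 * (p * c * t ^ (p - 1)) := by
    ring
  rw [h8, h4]
  linarith

/-- Absorption of the mixed term `t ^ (p - 1) * y`, in the form used to pass from the Bellman
function back to `t ^ p`. -/
theorem rpow_le_two_mul_bellman_add {p t y : ℝ} (hp : 1 < p) (ht : 0 ≤ t) (hy : 0 ≤ y) :
    t ^ p ≤ 2 * (t ^ (p - 1) * (t - p * y)) + (2 * p * y) ^ p := by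
  have hz : 0 ≤ 2 * p * y := by positivity
  -- It remains to see `t ^ (p - 1) * z ≤ t ^ p + z ^ p` for `z = 2 * p * y`.
  have key : t ^ (p - 1) * (2 * p * y) ≤ t ^ p + (2 * p * y) ^ p := by
    have hzp := Real.rpow_nonneg hz p
    have htp := Real.rpow_nonneg ht p
    rcases le_total t (2 * p * y) with h | h
    · have := mul_le_mul_of_nonneg_right
        (Real.rpow_le_rpow ht h (by linarith : 0 ≤ p - 1)) hz
      rw [rpow_sub_one_mul_self hp hz] at this
      linarith
    · have := mul_le_mul_of_nonneg_left h (Real.rpow_nonneg ht (p - 1))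
      rw [rpow_sub_one_mul_self hp ht] at this
      linarith
  have := rpow_sub_one_mul_self hp ht
  nlinarith

/-! ### Dyadic intervals and averages -/

theorem floor_mul_two_pow_of_le {x y : ℝ} {j k : ℕ} (hjk : j ≤ k)
    (h : ⌊x * 2 ^ k⌋ = ⌊y * 2 ^ k⌋) : ⌊x * 2 ^ j⌋ = ⌊y * 2 ^ j⌋ := by
  have key : ∀ z : ℝ, ⌊z * 2 ^ j⌋ = ⌊z * 2 ^ k⌋ / ((2 ^ (k - j) : ℕ) : ℤ) := fun z => by
    rw [← Int.floor_div_natCast]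
    congr 1
    push_cast
    rw [eq_div_iff (by positivity), mul_assoc, ← pow_add, Nat.add_sub_cancel' hjk]
  rw [key, key, h]

theorem floor_natCast_div_mul (k m : ℕ) : ⌊(m : ℝ) / 2 ^ k * 2 ^ k⌋ = m := by
  rw [div_mul_cancel₀ _ (by positivity)]
  simp

theorem measurableSet_dyadicInterval (k : ℕ) (m : ℤ) : MeasurableSet (dyadicInterval k m) :=
  measurableSet_Ico

theorem volume_dyadicInterval (k : ℕ) (m : ℤ) :
    volume (dyadicInterval k m) = ((2 : ℝ≥0∞) ^ k)⁻¹ := by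
  rw [dyadicInterval, Real.volume_Ico, ← sub_div, add_sub_cancel_left, one_div,
    ENNReal.ofReal_inv_of_pos (by positivity), ENNReal.ofReal_pow (by norm_num)]
  simp

theorem dyadicInterval_subset {k m : ℕ} (hm : m < 2 ^ k) :
    dyadicInterval k m ⊆ Set.Ico (0 : ℝ) 1 := by
  have h2 : (0 : ℝ) < 2 ^ k := by positivity
  refine Set.Ico_subset_Ico (by positivity) ?_
  rw [div_le_one h2]
  exact_mod_cast hm

theorem pairwise_disjoint_dyadicInterval (k : ℕ) :
    Pairwise (Function.onFun Disjoint fun m : ℕ => dyadicInterval k m) := by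
  intro m m' hne
  refine Set.disjoint_left.2 fun x hx hx' => hne ?_
  rw [mem_dyadicInterval_iff] at hx hx'
  exact_mod_cast hx.trans hx'.symm

theorem iUnion_dyadicInterval (k : ℕ) :
    ⋃ m ∈ Finset.range (2 ^ k), dyadicInterval k (m : ℕ) = Set.Ico (0 : ℝ) 1 := by
  refine Set.Subset.antisymm
    (Set.iUnion₂_subset fun m hm => dyadicInterval_subset (Finset.mem_range.1 hm)) ?_
  intro x hx
  have h2 : (0 : ℝ) < 2 ^ k := by positivity
  have h0 : (0 : ℤ) ≤ ⌊x * 2 ^ k⌋ := Int.floor_nonneg.mpr (mul_nonneg hx.1 h2.le)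
  have h1 : ⌊x * 2 ^ k⌋ < (2 : ℤ) ^ k := by
    rw [Int.floor_lt]
    push_cast
    nlinarith [hx.2]
  obtain ⟨m, hm⟩ := Int.eq_ofNat_of_zero_le h0
  simp only [Set.mem_iUnion, Finset.mem_range]
  refine ⟨m, ?_, (mem_dyadicInterval_iff _ _ _).2 hm.symm⟩
  rw [hm] at h1
  exact_mod_cast h1

theorem setLIntegral_Ico_eq_sum (k : ℕ) (g : ℝ → ℝ≥0∞) :
    ∫⁻ x in Set.Ico (0 : ℝ) 1, g x
      = ∑ m ∈ Finset.range (2 ^ k), ∫⁻ x in dyadicInterval k (m : ℕ), g x := by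
  rw [← iUnion_dyadicInterval k]
  exact lintegral_biUnion_finset ((pairwise_disjoint_dyadicInterval k).set_pairwise _)
    (fun m _ => measurableSet_dyadicInterval k m) g

variable {𝕜 : Type*} [RCLike 𝕜]

theorem dyadicAvg_congr {j k : ℕ} {x y : ℝ} (f : ℝ → 𝕜) (hjk : j ≤ k)
    (h : ⌊x * 2 ^ k⌋ = ⌊y * 2 ^ k⌋) : dyadicAvg j f x = dyadicAvg j f y := by
  rw [dyadicAvg, dyadicAvg, dyadicIntervalAt, dyadicIntervalAt, floor_mul_two_pow_of_le hjk h]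

theorem dyadicAvg_natCast_div (k m : ℕ) (f : ℝ → 𝕜) :
    dyadicAvg k f ((m : ℝ) / 2 ^ k) = (2 : ℝ) ^ k • ∫ y in dyadicInterval k m, f y := by
  rw [dyadicAvg, dyadicIntervalAt, floor_natCast_div_mul]

theorem dyadicInterval_union_halves (k m : ℕ) :
    dyadicInterval k m
      = dyadicInterval (k + 1) (2 * m : ℕ) ∪ dyadicInterval (k + 1) (2 * m + 1 : ℕ) := by
  have h2 : (0 : ℝ) < 2 ^ k := by positivity
  rw [dyadicInterval, dyadicInterval, dyadicInterval]
  push_cast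
  have e1 : (2 * (m : ℝ) + 1) / 2 ^ (k + 1) = (m + 1 / 2) / 2 ^ k := by
    rw [pow_succ]; field_simp
  rw [e1, Set.Ico_union_Ico_eq_Ico]
  · congr 1 <;> rw [pow_succ] <;> field_simp
    ring
  · rw [← e1]
    gcongr
    linarith
  · rw [← e1]
    gcongr
    linarith

/-- The martingale property: an average is the mean of the averages over the two halves. -/
theorem dyadicAvg_halves {f : ℝ → 𝕜} (hf : IntegrableOn f (Set.Ico (0 : ℝ) 1) volume)
    {k m : ℕ} (hm : m < 2 ^ k) :
    dyadicAvg (k + 1) f ((2 * m : ℕ) / 2 ^ (k + 1))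
        + dyadicAvg (k + 1) f ((2 * m + 1 : ℕ) / 2 ^ (k + 1))
      = 2 * dyadicAvg k f (m / 2 ^ k) := by
  have hlt : 2 * m + 1 < 2 ^ (k + 1) := by rw [pow_succ]; omega
  rw [dyadicAvg_natCast_div, dyadicAvg_natCast_div, dyadicAvg_natCast_div,
    dyadicInterval_union_halves k m,
    setIntegral_union (pairwise_disjoint_dyadicInterval (k + 1) (by omega))
      (measurableSet_dyadicInterval _ _)
      (hf.mono_set (dyadicInterval_subset (by omega)))
      (hf.mono_set (dyadicInterval_subset hlt))]
  simp only [RCLike.real_smul_eq_coe_mul, pow_succ]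
  push_cast
  ring

theorem measurable_dyadicAvg (k : ℕ) (f : ℝ → 𝕜) : Measurable (dyadicAvg k f) := by
  have h : Measurable fun m : ℤ => (2 : ℝ) ^ k • ∫ y in dyadicInterval k m, f y :=
    measurable_from_top
  have h' : Measurable fun x : ℝ => ⌊x * 2 ^ k⌋ :=
    Int.measurable_floor.comp (measurable_id.mul_const _)
  exact h.comp h'

/-- Jensen's inequality on a single dyadic interval. -/
theorem enorm_dyadicAvg_rpow_le {f : ℝ → 𝕜}
    (hf : IntegrableOn f (Set.Ico (0 : ℝ) 1) volume) {q : ℝ} (hq : 1 ≤ q) {k m : ℕ}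
    (hm : m < 2 ^ k) :
    ((2 : ℝ≥0∞) ^ k)⁻¹ * ‖dyadicAvg k f (m / 2 ^ k)‖ₑ ^ q
      ≤ ∫⁻ y in dyadicInterval k m, ‖f y‖ₑ ^ q := by
  set J := dyadicInterval k m with hJ
  have hq0 : 0 < q := by linarith
  set v : ℝ≥0∞ := (2 : ℝ≥0∞) ^ k with hv
  have hv0 : v ≠ 0 := by positivity
  have hvt : v ≠ ⊤ := ENNReal.pow_ne_top (by norm_num)
  have hvol : volume.restrict J Set.univ = v⁻¹ := by
    rw [Measure.restrict_apply_univ, volume_dyadicInterval]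
  have h1 := eLpNorm'_le_eLpNorm'_mul_rpow_measure_univ (μ := volume.restrict J) one_pos hq
    (hf.mono_set (dyadicInterval_subset hm)).aestronglyMeasurable
  rw [hvol] at h1
  simp only [eLpNorm', ENNReal.rpow_one, div_one] at h1
  have h2 : ‖dyadicAvg k f (m / 2 ^ k)‖ₑ ≤ v * ∫⁻ y in J, ‖f y‖ₑ := by
    rw [dyadicAvg_natCast_div, enorm_smul]
    have : ‖(2 : ℝ) ^ k‖ₑ = v := by
      rw [enorm_pow]
      simp [hv, enorm_eq_nnnorm]
    rw [this]
    gcongr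
    exact enorm_integral_le_lintegral_enorm _
  calc v⁻¹ * ‖dyadicAvg k f (m / 2 ^ k)‖ₑ ^ q
      ≤ v⁻¹ * (v * ((∫⁻ y in J, ‖f y‖ₑ ^ q) ^ (1 / q) * v⁻¹ ^ (1 - 1 / q))) ^ q := by
        gcongr
        exact h2.trans (by gcongr)
    _ = v⁻¹ * (v ^ q * ((∫⁻ y in J, ‖f y‖ₑ ^ q) * v⁻¹ ^ (q - 1))) := by
        rw [ENNReal.mul_rpow_of_nonneg _ _ hq0.le, ENNReal.mul_rpow_of_nonneg _ _ hq0.le,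
          ← ENNReal.rpow_mul, ← ENNReal.rpow_mul, one_div, inv_mul_cancel₀ hq0.ne',
          ENNReal.rpow_one, sub_mul, inv_mul_cancel₀ hq0.ne', one_mul]
    _ = (v ^ q * (v⁻¹ * v⁻¹ ^ (q - 1))) * ∫⁻ y in J, ‖f y‖ₑ ^ q := by ring
    _ = ∫⁻ y in J, ‖f y‖ₑ ^ q := by
        have : v⁻¹ * v⁻¹ ^ (q - 1) = v⁻¹ ^ q := by
          conv_lhs => enter [1]; rw [← ENNReal.rpow_one v⁻¹]
          rw [← ENNReal.rpow_add _ _ (ENNReal.inv_ne_zero.2 hvt) (ENNReal.inv_ne_top.2 hv0)]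
          congr 1
          ring
        rw [this, ← ENNReal.mul_rpow_of_nonneg _ _ hq0.le, ENNReal.mul_inv_cancel hv0 hvt,
          ENNReal.one_rpow, one_mul]

/-! ### The truncated square function -/

/-- The square of the square function truncated at level `n`,
`|E_0(f)(x)|² + ∑_{1 ≤ j ≤ n} |E_j(f)(x) - E_{j-1}(f)(x)|²`; as in `squareFunction`, the sum is
indexed by `j = i + 1`. -/
noncomputable def partialSq (n : ℕ) (f : ℝ → 𝕜) (x : ℝ) : ℝ :=
  ‖dyadicAvg 0 f x‖ ^ 2
    + ∑ i ∈ Finset.range n, ‖dyadicAvg (i + 1) f x - dyadicAvg i f x‖ ^ 2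

theorem partialSq_nonneg (n : ℕ) (f : ℝ → 𝕜) (x : ℝ) : 0 ≤ partialSq n f x := by
  unfold partialSq
  positivity

theorem partialSq_succ (n : ℕ) (f : ℝ → 𝕜) (x : ℝ) :
    partialSq (n + 1) f x
      = partialSq n f x + ‖dyadicAvg (n + 1) f x - dyadicAvg n f x‖ ^ 2 := by
  rw [partialSq, partialSq, Finset.sum_range_succ, add_assoc]

theorem partialSq_congr {n : ℕ} {x y : ℝ} (f : ℝ → 𝕜) (h : ⌊x * 2 ^ n⌋ = ⌊y * 2 ^ n⌋) :
    partialSq n f x = partialSq n f y := by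
  rw [partialSq, partialSq, dyadicAvg_congr f (Nat.zero_le n) h]
  congr 1
  refine Finset.sum_congr rfl fun i hi => ?_
  rw [Finset.mem_range] at hi
  rw [dyadicAvg_congr f hi h, dyadicAvg_congr f hi.le h]

theorem measurable_partialSq (n : ℕ) (f : ℝ → 𝕜) : Measurable (partialSq n f) := by
  refine ((measurable_dyadicAvg 0 f).norm.pow_const 2).add ?_
  exact Finset.measurable_fun_sum _ fun i _ =>
    ((measurable_dyadicAvg (i + 1) f).sub (measurable_dyadicAvg i f)).norm.pow_const 2

theorem monotone_partialSq (f : ℝ → 𝕜) (x : ℝ) : Monotone fun n => partialSq n f x := by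
  refine monotone_nat_of_le_succ fun n => ?_
  rw [partialSq_succ]
  exact le_add_of_nonneg_right (by positivity)

theorem squareFunction_rpow (f : ℝ → 𝕜) (x : ℝ) {q : ℝ} (hq : 0 < q) :
    squareFunction f x ^ q = ⨆ n, ENNReal.ofReal (partialSq n f x) ^ (q / 2) := by
  have h : ∀ n, ENNReal.ofReal (partialSq n f x) = ‖dyadicAvg 0 f x‖ₑ ^ 2
      + ∑ i ∈ Finset.range n, ‖dyadicAvg (i + 1) f x - dyadicAvg i f x‖ₑ ^ 2 := fun n => by
    rw [partialSq, ENNReal.ofReal_add (by positivity) (by positivity),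
      ENNReal.ofReal_sum_of_nonneg (fun _ _ => by positivity)]
    simp only [ENNReal.ofReal_pow (norm_nonneg _), ofReal_norm]
  simp only [h]
  rw [squareFunction, ← ENNReal.rpow_mul, one_div_mul_eq_div, ENNReal.tsum_eq_iSup_nat,
    ENNReal.add_iSup]
  exact (ENNReal.orderIsoRpow (q / 2) (by positivity)).map_iSup _

/-- The truncated square function is constant on the dyadic intervals of level `n`, so its
integral is a mean of its values at their left endpoints. -/
theorem setLIntegral_partialSq_rpow (n : ℕ) (f : ℝ → 𝕜) {p : ℝ} (hp : 0 ≤ p) :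
    ∫⁻ x in Set.Ico (0 : ℝ) 1, ENNReal.ofReal (partialSq n f x) ^ p
      = ((2 : ℝ≥0∞) ^ n)⁻¹
        * ENNReal.ofReal (∑ m ∈ Finset.range (2 ^ n), partialSq n f ((m : ℕ) / 2 ^ n) ^ p) := by
  rw [setLIntegral_Ico_eq_sum n, ENNReal.ofReal_sum_of_nonneg
    (fun _ _ => Real.rpow_nonneg (partialSq_nonneg _ _ _) _), Finset.mul_sum]
  refine Finset.sum_congr rfl fun m _ => ?_
  rw [setLIntegral_congr_fun (g := fun _ => ENNReal.ofReal (partialSq n f (m / 2 ^ n) ^ p))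
    (measurableSet_dyadicInterval n m), setLIntegral_const, volume_dyadicInterval, mul_comm]
  intro x hx
  rw [mem_dyadicInterval_iff] at hx
  simp only
  rw [← ENNReal.ofReal_rpow_of_nonneg (partialSq_nonneg _ _ _) hp,
    partialSq_congr f (hx.symm.trans (floor_natCast_div_mul n m).symm)]

/-! ### The supermartingale estimate -/

theorem sum_range_two_pow_succ (n : ℕ) (g : ℕ → ℝ) :
    ∑ m ∈ Finset.range (2 ^ (n + 1)), g m
      = ∑ m ∈ Finset.range (2 ^ n), (g (2 * m) + g (2 * m + 1)) := by
  rw [pow_succ, mul_comm]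
  induction 2 ^ n with
  | zero => simp
  | succ N ih =>
    rw [mul_add, mul_one, Finset.sum_range_succ, Finset.sum_range_succ, ih,
      Finset.sum_range_succ, add_assoc]

/-- The sum over all dyadic intervals of level `n` of the Bellman function of the truncated square
function and the average is nonpositive. -/
theorem sum_bellman_nonpos {f : ℝ → 𝕜} (hf : IntegrableOn f (Set.Ico (0 : ℝ) 1) volume)
    {p : ℝ} (hp : 1 < p) (n : ℕ) :
    ∑ m ∈ Finset.range (2 ^ n), partialSq n f ((m : ℕ) / 2 ^ n) ^ (p - 1)
      * (partialSq n f ((m : ℕ) / 2 ^ n) - p * ‖dyadicAvg n f ((m : ℕ) / 2 ^ n)‖ ^ 2) ≤ 0 := by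
  induction n with
  | zero =>
    simp only [pow_zero, Finset.range_one, Finset.sum_singleton, partialSq, Finset.range_zero,
      Finset.sum_empty, add_zero]
    refine mul_nonpos_of_nonneg_of_nonpos (by positivity) ?_
    nlinarith [sq_nonneg ‖dyadicAvg 0 f (((0 : ℕ) : ℝ) / 1)‖]
  | succ n ih =>
    rw [sum_range_two_pow_succ]
    refine (Finset.sum_le_sum (g := fun m : ℕ => 2 * (partialSq n f (m / 2 ^ n) ^ (p - 1)
      * (partialSq n f (m / 2 ^ n) - p * ‖dyadicAvg n f (m / 2 ^ n)‖ ^ 2)))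
      fun m hm => ?_).trans ?_
    · have hm' := Finset.mem_range.1 hm
      have hsum := dyadicAvg_halves hf hm'
      set x : ℝ := (m : ℝ) / 2 ^ n with hx
      set x₀ : ℝ := (2 * m : ℕ) / 2 ^ (n + 1) with hx₀
      set x₁ : ℝ := (2 * m + 1 : ℕ) / 2 ^ (n + 1) with hx₁
      have hfl : ⌊x * 2 ^ n⌋ = m := floor_natCast_div_mul n m
      have hfl₀ : ⌊x₀ * 2 ^ n⌋ = m := by
        refine ((mem_dyadicInterval_iff n m x₀).1 ?_).symm
        rw [dyadicInterval_union_halves]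
        exact Or.inl ((mem_dyadicInterval_iff _ _ _).2 (floor_natCast_div_mul _ _).symm)
      have hfl₁ : ⌊x₁ * 2 ^ n⌋ = m := by
        refine ((mem_dyadicInterval_iff n m x₁).1 ?_).symm
        rw [dyadicInterval_union_halves]
        exact Or.inr ((mem_dyadicInterval_iff _ _ _).2 (floor_natCast_div_mul _ _).symm)
      rw [partialSq_succ, partialSq_succ,
        partialSq_congr f (hfl₀.trans hfl.symm), partialSq_congr f (hfl₁.trans hfl.symm),
        dyadicAvg_congr f le_rfl (hfl₀.trans hfl.symm),
        dyadicAvg_congr f le_rfl (hfl₁.trans hfl.symm)]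
      set a := dyadicAvg (n + 1) f x₀
      set b := dyadicAvg (n + 1) f x₁
      set c := dyadicAvg n f x
      -- The jumps on the two halves are opposite to each other.
      have hb : b - c = -(a - c) := by linear_combination hsum
      have hnorm : ‖b - c‖ = ‖a - c‖ := by rw [hb, norm_neg]
      rw [hnorm]
      have hpar := parallelogram_law_with_norm ℝ c (a - c)
      rw [show c + (a - c) = a by ring, show c - (a - c) = b by linear_combination -hsum] at hpar
      exact bellman_step hp (partialSq_nonneg _ _ _) (by positivity) (by positivity)
        (by linarith [sq ‖a‖, sq ‖b‖, sq ‖c‖, sq ‖a - c‖])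
    · rw [← Finset.mul_sum]
      linarith

theorem sum_partialSq_rpow_le {f : ℝ → 𝕜} (hf : IntegrableOn f (Set.Ico (0 : ℝ) 1) volume)
    {q : ℝ} (hq : 2 < q) (n : ℕ) :
    ∑ m ∈ Finset.range (2 ^ n), partialSq n f ((m : ℕ) / 2 ^ n) ^ (q / 2)
      ≤ q ^ (q / 2) * ∑ m ∈ Finset.range (2 ^ n), ‖dyadicAvg n f ((m : ℕ) / 2 ^ n)‖ ^ q := by
  have hp : 1 < q / 2 := by linarith
  refine (Finset.sum_le_sum fun m _ => rpow_le_two_mul_bellman_add hp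
    (partialSq_nonneg n f ((m : ℕ) / 2 ^ n))
    (sq_nonneg ‖dyadicAvg n f ((m : ℕ) / 2 ^ n)‖)).trans ?_
  rw [Finset.sum_add_distrib]
  have h := sum_bellman_nonpos hf hp n
  have h' : ∀ m : ℕ, (2 * (q / 2) * ‖dyadicAvg n f ((m : ℕ) / 2 ^ n)‖ ^ 2) ^ (q / 2)
      = q ^ (q / 2) * ‖dyadicAvg n f ((m : ℕ) / 2 ^ n)‖ ^ q := fun m => by
    rw [mul_div_cancel₀ q two_ne_zero, Real.mul_rpow (by linarith) (by positivity),
      ← Real.rpow_natCast, ← Real.rpow_mul (norm_nonneg _)]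
    congr 2
    push_cast
    ring
  simp only [h', ← Finset.mul_sum]
  linarith

theorem setLIntegral_partialSq_le {f : ℝ → 𝕜}
    (hf : IntegrableOn f (Set.Ico (0 : ℝ) 1) volume) {q : ℝ} (hq : 2 < q) (n : ℕ) :
    ∫⁻ x in Set.Ico (0 : ℝ) 1, ENNReal.ofReal (partialSq n f x) ^ (q / 2)
      ≤ ENNReal.ofReal (q ^ (q / 2)) * ∫⁻ x in Set.Ico (0 : ℝ) 1, ‖f x‖ₑ ^ q := by
  have hq0 : 0 ≤ q := by linarith
  rw [setLIntegral_partialSq_rpow n f (by linarith), setLIntegral_Ico_eq_sum n]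
  calc _ ≤ ((2 : ℝ≥0∞) ^ n)⁻¹ * ENNReal.ofReal (q ^ (q / 2)
          * ∑ m ∈ Finset.range (2 ^ n), ‖dyadicAvg n f ((m : ℕ) / 2 ^ n)‖ ^ q) := by
        gcongr
        exact sum_partialSq_rpow_le hf hq n
    _ = ENNReal.ofReal (q ^ (q / 2)) * ∑ m ∈ Finset.range (2 ^ n),
          ((2 : ℝ≥0∞) ^ n)⁻¹ * ‖dyadicAvg n f ((m : ℕ) / 2 ^ n)‖ₑ ^ q := by
        rw [ENNReal.ofReal_mul (by positivity), ENNReal.ofReal_sum_of_nonneg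
          (fun _ _ => by positivity), ← Finset.mul_sum, mul_left_comm]
        simp only [← ENNReal.ofReal_rpow_of_nonneg (norm_nonneg _) hq0, ofReal_norm]
    _ ≤ _ := by
        gcongr with m hm
        exact enorm_dyadicAvg_rpow_le hf (by linarith) (Finset.mem_range.1 hm)

end DyadicSquare

theorem mainTheorem8 (q : ℝ) (hq : 2 < q) :
    ∃ C : ℝ, 0 < C ∧
      ∀ (𝕜 : Type) [RCLike 𝕜] (f : ℝ → 𝕜), IntegrableOn f (Set.Ico (0 : ℝ) 1) volume →
        ∫⁻ x in Set.Ico (0 : ℝ) 1, DyadicSquare.squareFunction f x ^ q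
          ≤ ENNReal.ofReal C * ∫⁻ x in Set.Ico (0 : ℝ) 1, ‖f x‖ₑ ^ q := by
  have hq0 : 0 < q := by linarith
  refine ⟨q ^ (q / 2), by positivity, fun 𝕜 _ f hf => ?_⟩
  simp only [DyadicSquare.squareFunction_rpow f _ hq0]
  rw [lintegral_iSup]
  · exact iSup_le fun n => DyadicSquare.setLIntegral_partialSq_le hf hq n
  · exact fun n => (DyadicSquare.measurable_partialSq n f).ennreal_ofReal.pow_const _
  · intro n n' h x
    dsimp only
    gcongr
    exact DyadicSquare.monotone_partialSq f x h
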